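/- Let $n\ge 1$ be an integer, let $\mathbb S^n\subseteq\mathbb R^{n+1}$ be the unit sphere with the Riemannian metric induced by $\mathbb R^{n+1}$ and its volume measure $dq$, and let $V_n=\mathrm{vol}(\mathbb S^n)=2\pi^{\frac{n+1}{2}}/\Gamma\left(\frac{n+1}{2}\right)$. Let $\Delta=-\mathrm{div}\,\nabla$ be the Laplace--Beltrami operator of $\mathbb S^n$. A Green function of $\mathbb S^n$ is a function $G:\{(p,q)\in\mathbb S^n\times\mathbb S^n: p\ne q\}\to\mathbb R$ that is continuous, with $G(p,\cdot)$ integrable on $\mathbb S^n$ for every $p$, and such that 1. $\Delta_q G(p,\cdot)=\delta_p-V_n^{-1}$ in the sense of distributions for every $p$, that is, $\int_{\mathbb S^n}G(p,q)\,\Delta f(q)\,dq=f(p)-V_n^{-1}\int_{\mathbb S^n}f(q)\,dq$ for every $f\in C^\infty(\mathbb S^n)$; 2. $G(p,q)=G(q,p)$ for all $p\ne q$; 3. $\int_{\mathbb S^n}G(p,q)\,dq=0$ for every $p$. For $0<t\le 2$ put $$g(t)=\frac{2}{nV_n}\sum_{k=0}^{\infty}\frac{(n)_k}{(k+1)\left(\frac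 n2+1\right)_k}\left[\left(1-\frac{t^2}{4}\right)^{k+1}-\frac{B\left(\frac n2,\frac n2+k+1\right)}{B\left(\frac n2,\frac n2\right)}\right],$$ where $(x)_k=x(x+1)\cdots(x+k-1)$, $(x)_0=1$, is the Pochhammer symbol and $B(a,b)=\int_0^1 t^{a-1}(1-t)^{b-1}\,dt$ is Euler's beta function. Then this series converges absolutely for every $0<t\le 2$, and $\mathbb S^n$ has exactly one Green function, namely $G(p,q)=g(\|p-q\|)$ for $p\ne q$, where $\|\cdot\|$ is the Euclidean norm. -/

import Mathlib

open MeasureTheory Set Metric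
open scoped Manifold ContDiff

noncomputable section

namespace SphereGreen

/-- The Euclidean space `ℝ^{n+1}` containing the sphere `S^n`. -/
abbrev Ambient (n : ℕ) : Type := EuclideanSpace ℝ (Fin (n + 1))

/-- The unit sphere `S^n ⊆ ℝ^{n+1}`, with Mathlib's smooth structure (its charts are the
stereographic projections). -/
abbrev Sph (n : ℕ) : Type := sphere (0 : Ambient n) 1

/-- The Riemannian volume of `S^n`: the surface measure of the unit sphere. -/
abbrev vol (n : ℕ) : Measure (Sph n) := (volume : Measure (Ambient n)).toSphere

/-- The partial derivative `∂_i h (x)` of a function on `ℝ^n`. -/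
def partialDeriv {n : ℕ} {F : Type*} [NormedAddCommGroup F] [NormedSpace ℝ F]
    (i : Fin n) (h : EuclideanSpace ℝ (Fin n) → F) (x : EuclideanSpace ℝ (Fin n)) : F :=
  fderiv ℝ h x (EuclideanSpace.single i 1)

/-- The matrix `(g_ij)` at `x`, in the chart `e`, of the Riemannian metric of `S^n` induced by
`ℝ^{n+1}`: the inner products of the coordinate tangent vectors `∂_i e⁻¹ (x)`, `∂_j e⁻¹ (x)`. -/
def metricMatrix {n : ℕ} (e : OpenPartialHomeomorph (Sph n) (EuclideanSpace ℝ (Fin n)))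
    (x : EuclideanSpace ℝ (Fin n)) : Matrix (Fin n) (Fin n) ℝ :=
  Matrix.of fun i j =>
    inner ℝ (partialDeriv i (fun y => (e.symm y : Ambient n)) x)
      (partialDeriv j (fun y => (e.symm y : Ambient n)) x)

/-- The `i`-th component `∑ j, g^{ij} ∂_j f` of the Riemannian gradient of `f` in the chart `e`. -/
def gradInChart {n : ℕ} (e : OpenPartialHomeomorph (Sph n) (EuclideanSpace ℝ (Fin n)))
    (f : Sph n → ℝ) (i : Fin n) (x : EuclideanSpace ℝ (Fin n)) : ℝ :=
  ∑ j, (metricMatrix e x)⁻¹ i j * partialDeriv j (fun y => f (e.symm y)) x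

/-- The Riemannian divergence `(1 / √det g) ∑ i, ∂_i (√det g · X^i)`, in the chart `e`, of the
vector field with components `X^i`. -/
def divInChart {n : ℕ} (e : OpenPartialHomeomorph (Sph n) (EuclideanSpace ℝ (Fin n)))
    (X : Fin n → EuclideanSpace ℝ (Fin n) → ℝ) (x : EuclideanSpace ℝ (Fin n)) : ℝ :=
  (√(metricMatrix e x).det)⁻¹ *
    ∑ i, partialDeriv i (fun y => √(metricMatrix e y).det * X i y) x

/-- The Laplace–Beltrami operator `Δ = - div ∇` of `S^n` (nonnegative sign convention), computed
at `p` in the preferred chart around `p`. -/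
def laplaceBeltrami {n : ℕ} (f : Sph n → ℝ) (p : Sph n) : ℝ :=
  -divInChart (chartAt (EuclideanSpace ℝ (Fin n)) p)
    (gradInChart (chartAt (EuclideanSpace ℝ (Fin n)) p) f)
    (chartAt (EuclideanSpace ℝ (Fin n)) p p)

/-- `G` is a Green function of `S^n`. Only the values of `G` off the diagonal matter (for `1 ≤ n`,
points are null sets), so that `G` may be given as a function of all pairs. -/
structure IsGreenFunction (n : ℕ) (G : Sph n → Sph n → ℝ) : Prop where
  /-- `G` is continuous off the diagonal. -/
  continuousOn : ContinuousOn (fun x : Sph n × Sph n => G x.1 x.2) {x | x.1 ≠ x.2}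
  /-- `G(p, ·)` is integrable; in particular it is a distribution on `S^n`. -/
  integrable : ∀ p, Integrable (G p) (vol n)
  /-- `Δ_q G(p, ·) = δ_p - vol(S^n)⁻¹` in the sense of distributions. -/
  laplacian : ∀ (p : Sph n) (f : Sph n → ℝ), ContMDiff (𝓡 n) 𝓘(ℝ, ℝ) ∞ f →
    ∫ q, G p q * laplaceBeltrami f q ∂(vol n) =
      f p - ((vol n).real univ)⁻¹ * ∫ q, f q ∂(vol n)
  /-- `G` is symmetric. -/
  symm : ∀ p q, p ≠ q → G p q = G q p
  /-- `G(p, ·)` has mean zero. -/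
  mean_zero : ∀ p, ∫ q, G p q ∂(vol n) = 0

/-- The constant `V_n = 2 π^{(n+1)/2} / Γ((n+1)/2)`. -/
def V (n : ℕ) : ℝ := 2 * Real.pi ^ (((n : ℝ) + 1) / 2) / Real.Gamma (((n : ℝ) + 1) / 2)

/-- Euler's beta function `B(a, b) = ∫₀¹ t^{a-1} (1-t)^{b-1} dt`. -/
def B (a b : ℝ) : ℝ := ∫ t in (0 : ℝ)..1, t ^ (a - 1) * (1 - t) ^ (b - 1)

/-- The Pochhammer symbol `(x)_k = x (x+1) ⋯ (x+k-1)`. -/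
def poch (x : ℝ) (k : ℕ) : ℝ := ∏ i ∈ Finset.range k, (x + i)

/-- The `k`-th term of the series defining `g(t)`. -/
def greenTerm (n : ℕ) (t : ℝ) (k : ℕ) : ℝ :=
  poch n k / (((k : ℝ) + 1) * poch ((n : ℝ) / 2 + 1) k) *
    ((1 - t ^ 2 / 4) ^ (k + 1) -
      B ((n : ℝ) / 2) ((n : ℝ) / 2 + k + 1) / B ((n : ℝ) / 2) ((n : ℝ) / 2))

/-- The function `g(t)`. -/
def g (n : ℕ) (t : ℝ) : ℝ := 2 / (n * V n) * ∑' k : ℕ, greenTerm n t k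

end SphereGreen

end

/-! Put `x = zonal p q`, that is `(1 + ⟪p, q⟫) / 2 = 1 - ‖p - q‖² / 4`. The Laplacian acts on powers
of `x` by a two-term rule (`laplaceBeltrami_zonal_pow_succ`), and the coefficients `c_k` of the
series are exactly those for which it telescopes: `Δ ∑_{k<N} c_k x^(k+1) = a_N x^N - n/2`
(`sum_coef_mul_laplaceBeltrami`). Since `∫ a_N x^N = (n/2) V_n` for every `N` and `x` has its strict
maximum `1` at `q = p`, the kernels `a_N x^N` concentrate to `(n/2) V_n δ_p`
(`tendsto_peakFactor_mul_integral`). Dividing by `(n/2) V_n` gives `δ_p - 1/V_n`.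

Existence and uniqueness are the same limit, applied to different integrands. For existence, the
series is integrated termwise against `Δf`, and `Δ` is moved onto the powers by symmetry. For
uniqueness, the equation for `G(p, ·)` is tested against powers of `zonal q`, peaked at `q ≠ p`: the
kernels recover `G p q`, while the tested values are the partial sums of the series.

Two facts tie this to the chart definition of `Δ`. It is minus the Euclidean Laplacian of the
`0`-homogeneous extension (`laplaceBeltrami_eq_laplacian`), and it is symmetric
(`integral_mul_laplaceBeltrami_comm`), by the divergence theorem in `ℝ^{n+1}` with a radial cut-off.
-/

noncomputable section

namespace SphereGreen

open Filter Topology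

/-! ### Coefficients, convergence of the series, and total volume -/

section Series

theorem poch_succ (x : ℝ) (k : ℕ) : poch x (k + 1) = poch x k * (x + k) :=
  Finset.prod_range_succ _ _

theorem poch_succ_left (x : ℝ) (k : ℕ) : poch x (k + 1) = x * poch (x + 1) k := by
  unfold poch
  rw [Finset.prod_range_succ', mul_comm]
  simp [add_comm, add_left_comm]

theorem poch_pos {x : ℝ} (hx : 0 < x) (k : ℕ) : 0 < poch x k :=
  Finset.prod_pos fun i _ => by positivity

theorem gamma_add_nat {x : ℝ} (hx : 0 < x) (k : ℕ) :
    Real.Gamma (x + k) = poch x k * Real.Gamma x := by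
  induction k with
  | zero => simp [poch]
  | succ k ih =>
    rw [poch_succ, Nat.cast_succ, ← add_assoc, Real.Gamma_add_one (by positivity), ih]
    ring

theorem B_eq_beta {a b : ℝ} (ha : 0 < a) (hb : 0 < b) : B a b = ProbabilityTheory.beta a b := by
  rw [ProbabilityTheory.beta_eq_betaIntegralReal a b ha hb, Complex.betaIntegral, B]
  have : ∫ x : ℝ in (0 : ℝ)..1, (x : ℂ) ^ ((a : ℂ) - 1) * (1 - (x : ℂ)) ^ ((b : ℂ) - 1) =
      ∫ x : ℝ in (0 : ℝ)..1, ((x ^ (a - 1) * (1 - x) ^ (b - 1) : ℝ) : ℂ) := by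
    refine intervalIntegral.integral_congr fun x hx => ?_
    rw [uIcc_of_le zero_le_one] at hx
    have h1 : 0 ≤ 1 - x := by linarith [hx.2]
    push_cast [Complex.ofReal_cpow hx.1, Complex.ofReal_cpow h1]
    rfl
  rw [this, intervalIntegral.integral_ofReal, Complex.ofReal_re]

theorem B_div_B {a : ℝ} (ha : 0 < a) (k : ℕ) :
    B a (a + k) / B a a = poch a k / poch (2 * a) k := by
  rw [B_eq_beta ha (by positivity), B_eq_beta ha ha]
  unfold ProbabilityTheory.beta
  rw [gamma_add_nat ha, ← add_assoc, ← two_mul, gamma_add_nat (by positivity : 0 < 2 * a)]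
  have h1 := (Real.Gamma_pos_of_pos ha).ne'
  have h2 := (Real.Gamma_pos_of_pos (by positivity : 0 < 2 * a)).ne'
  have h3 := (poch_pos (by positivity : 0 < 2 * a) k).ne'
  field_simp

/-- The coefficient of `x ^ (k + 1)` in the power series of the Green function. -/
def coef (n k : ℕ) : ℝ := poch n k / (((k : ℝ) + 1) * poch ((n : ℝ) / 2 + 1) k)

/-- The mean value over `S^n` of the `m`-th power of `q ↦ (1 + ⟪p, q⟫) / 2`. -/
def moment (n m : ℕ) : ℝ := poch ((n : ℝ) / 2) m / poch n m

variable {n : ℕ}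

theorem coef_pos (hn : 1 ≤ n) (k : ℕ) : 0 < coef n k := by
  have : 0 < (n : ℝ) := by exact_mod_cast hn
  exact div_pos (poch_pos this k) (mul_pos (by positivity) (poch_pos (by positivity) k))

theorem moment_pos (hn : 1 ≤ n) (m : ℕ) : 0 < moment n m := by
  have : 0 < (n : ℝ) := by exact_mod_cast hn
  exact div_pos (poch_pos (by positivity) m) (poch_pos this m)

theorem moment_succ (hn : 1 ≤ n) (m : ℕ) :
    ((n : ℝ) + m) * moment n (m + 1) = ((n : ℝ) / 2 + m) * moment n m := by
  have : 0 < (n : ℝ) := by exact_mod_cast hn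
  have h := (poch_pos this m).ne'
  unfold moment
  rw [poch_succ, poch_succ]
  field_simp

theorem greenTerm_eq (hn : 1 ≤ n) (t : ℝ) (k : ℕ) :
    greenTerm n t k = coef n k * ((1 - t ^ 2 / 4) ^ (k + 1) - moment n (k + 1)) := by
  have h0 : 0 < (n : ℝ) := by exact_mod_cast hn
  have h := B_div_B (by positivity : 0 < (n : ℝ) / 2) (k + 1)
  rw [mul_div_cancel₀ _ two_ne_zero] at h
  unfold greenTerm coef moment
  rw [← h, Nat.cast_succ, ← add_assoc]

/-- The Pochhammer factors cancel, leaving decay of order `k⁻²`. Up to the factor `V n` this is the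
`L¹` norm of `c_k x^(k+1)` on the sphere, so it controls every termwise integration below. -/
theorem coef_mul_moment (hn : 1 ≤ n) (k : ℕ) :
    coef n k * moment n (k + 1) = (n / 2) / (((k : ℝ) + 1) * (n + k)) := by
  have h0 : 0 < (n : ℝ) := by exact_mod_cast hn
  have h1 := (poch_pos h0 k).ne'
  have h2 := (poch_pos (by positivity : 0 < (n : ℝ) / 2 + 1) k).ne'
  unfold coef moment
  rw [poch_succ_left, poch_succ]
  generalize poch ((n : ℝ) / 2 + 1) k = P at *
  field_simp

/-- This recursion drives both the ratio test and the telescoping of the Laplacians. -/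
theorem coef_succ (hn : 1 ≤ n) (k : ℕ) :
    coef n (k + 1) * ((k + 2) * (k + 1 + n / 2)) = coef n k * ((k + 1) * (k + n)) := by
  have h0 : 0 < (n : ℝ) := by exact_mod_cast hn
  have h2 := (poch_pos (by positivity : 0 < (n : ℝ) / 2 + 1) k).ne'
  unfold coef
  rw [poch_succ, poch_succ]
  push_cast
  field_simp
  ring

theorem summable_coef_mul_moment (hn : 1 ≤ n) :
    Summable fun k => coef n k * moment n (k + 1) := by
  simp_rw [coef_mul_moment hn]
  have h0 : (1 : ℝ) ≤ (n : ℝ) := by exact_mod_cast hn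
  have h1 : Summable fun k : ℕ => (n / 2 : ℝ) * (1 / ((k + 1 : ℕ) : ℝ) ^ 2) :=
    ((summable_nat_add_iff 1).2 (Real.summable_one_div_nat_pow.2 one_lt_two)).mul_left _
  refine h1.of_nonneg_of_le (fun k => by positivity) fun k => ?_
  rw [← mul_one_div (n / 2 : ℝ)]
  have : (0 : ℝ) ≤ k := by positivity
  gcongr
  push_cast
  nlinarith

theorem summable_coef_mul_pow (hn : 1 ≤ n) {x : ℝ} (hx0 : 0 ≤ x) (hx : x < 1) :
    Summable fun k => coef n k * x ^ (k + 1) := by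
  rcases hx0.eq_or_lt with rfl | hx0
  -- The ratio test needs nonzero terms, so `x = 0` is treated apart.
  · simp [summable_zero]
  have h0 : 0 < (n : ℝ) := by exact_mod_cast hn
  refine summable_of_ratio_test_tendsto_lt_one hx (Eventually.of_forall fun k =>
    (mul_pos (coef_pos hn k) (by positivity)).ne') ?_
  have h (k : ℕ) : ‖coef n (k + 1) * x ^ (k + 1 + 1)‖ / ‖coef n k * x ^ (k + 1)‖ =
      x * ((((k : ℝ) + 1) / (k + 2)) * ((k + n) / (k + (1 + n / 2)))) := by
    rw [Real.norm_of_nonneg (mul_pos (coef_pos hn _) (by positivity)).le,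
      Real.norm_of_nonneg (mul_pos (coef_pos hn _) (by positivity)).le,
      div_eq_iff (mul_pos (coef_pos hn _) (by positivity)).ne']
    have h3 := coef_succ hn k
    have h4 : coef n (k + 1) = coef n k * ((k + 1) * (k + n)) / ((k + 2) * (k + 1 + n / 2)) := by
      rw [eq_div_iff (by positivity), h3]
    rw [h4, pow_succ _ (k + 1)]
    field_simp
    ring
  simp_rw [h]
  have hlim (a b : ℝ) : Tendsto (fun k : ℕ => ((k : ℝ) + a) / (k + b)) atTop (𝓝 1) := by
    have := tendsto_add_mul_div_add_mul_atTop_nhds a b 1 (one_ne_zero (α := ℝ))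
    simpa [add_comm] using this
  simpa using ((hlim 1 2).mul (hlim n (1 + n / 2))).const_mul x

theorem summable_greenTerm (hn : 1 ≤ n) {t : ℝ} (h0 : 0 < t) (h2 : t ≤ 2) :
    Summable (greenTerm n t) := by
  simp_rw [funext (greenTerm_eq hn t), mul_sub]
  exact (summable_coef_mul_pow hn (by nlinarith) (by nlinarith)).sub (summable_coef_mul_moment hn)

/-- The sum of the power series `∑ c_k x ^ (k + 1)`, normalized to have mean value zero. -/
def profile (n : ℕ) (x : ℝ) : ℝ := ∑' k, coef n k * (x ^ (k + 1) - moment n (k + 1))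

theorem g_eq (hn : 1 ≤ n) (t : ℝ) : g n t = 2 / (n * V n) * profile n (1 - t ^ 2 / 4) := by
  simp only [g, profile, greenTerm_eq hn]

theorem continuousOn_profile (hn : 1 ≤ n) : ContinuousOn (profile n) (Ico 0 1) := by
  intro x hx
  -- Convergence is uniform only on `[0, r]` with `r < 1`; the terms at `r` give the majorant.
  obtain ⟨r, hxr, hr⟩ := exists_between hx.2
  have h : ContinuousOn (profile n) (Icc 0 r) := by
    refine continuousOn_tsum (u := fun k => coef n k * r ^ (k + 1) + coef n k * moment n (k + 1))
      (fun k => by fun_prop)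
      ((summable_coef_mul_pow hn (hx.1.trans hxr.le) hr).add (summable_coef_mul_moment hn))
      fun k y hy => ?_
    have h1 : 0 ≤ y ^ (k + 1) := pow_nonneg hy.1 _
    have h2 : y ^ (k + 1) ≤ r ^ (k + 1) := pow_le_pow_left₀ hy.1 hy.2 _
    rw [norm_mul, Real.norm_of_nonneg (coef_pos hn k).le, ← mul_add]
    refine mul_le_mul_of_nonneg_left ?_ (coef_pos hn k).le
    rw [Real.norm_eq_abs, abs_le]
    constructor <;> linarith [moment_pos hn (k + 1)]
  refine (h x ⟨hx.1, hxr.le⟩).mono_of_mem_nhdsWithin ?_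
  filter_upwards [self_mem_nhdsWithin, mem_nhdsWithin_of_mem_nhds (Iio_mem_nhds hxr)]
    with y hy hyr using ⟨hy.1, le_of_lt hyr⟩

theorem tendsto_sum_profile (hn : 1 ≤ n) {x : ℝ} (h0 : 0 ≤ x) (h1 : x < 1) :
    Tendsto (fun N => ∑ k ∈ Finset.range N, coef n k * (x ^ (k + 1) - moment n (k + 1))) atTop
      (𝓝 (profile n x)) := by
  simp_rw [profile, mul_sub]
  exact ((summable_coef_mul_pow hn h0 h1).sub (summable_coef_mul_moment hn)).hasSum.tendsto_sum_nat

theorem vol_univ (n : ℕ) : (vol n).real univ = V n := by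
  rw [Measure.toSphere_real_apply_univ, Measure.real, EuclideanSpace.volume_ball]
  simp only [ENNReal.ofReal_one, one_pow, one_mul, finrank_euclideanSpace, Fintype.card_fin, V]
  rw [ENNReal.toReal_ofReal (by positivity)]
  have h : (0 : ℝ) < ((n : ℝ) + 1) / 2 := by positivity
  push_cast
  rw [Real.Gamma_add_one h.ne', Real.sqrt_eq_rpow, ← Real.rpow_natCast, ← Real.rpow_mul
    Real.pi_pos.le]
  have := (Real.Gamma_pos_of_pos h).ne'
  push_cast
  rw [show 1 / 2 * ((n : ℝ) + 1) = ((n : ℝ) + 1) / 2 by ring]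
  field_simp

end Series

/-! ### Stereographic charts and their derivatives -/

section Chart

variable {n : ℕ}

/-- The inverse of the preferred chart at `p` is the inverse stereographic projection from `-p`,
up to a linear isometry onto the orthogonal complement of `p`. -/
theorem exists_chartAt_symm (p : Sph n) :
    ∃ ι : EuclideanSpace ℝ (Fin n) →ₗᵢ[ℝ] Ambient n, (∀ y, inner ℝ (-p : Ambient n) (ι y) = 0) ∧
      (∀ y, ((chartAt (EuclideanSpace ℝ (Fin n)) p).symm y : Ambient n) =
        stereoInvFunAux (-p : Ambient n) (ι y)) ∧
      chartAt (EuclideanSpace ℝ (Fin n)) p p = 0 := by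
  have := Fact.mk (@finrank_euclideanSpace_fin ℝ _ (n + 1))
  let U := (OrthonormalBasis.fromOrthogonalSpanSingleton (𝕜 := ℝ) n
    (ne_zero_of_mem_unit_sphere (-p))).repr
  refine ⟨(Submodule.subtypeₗᵢ _).comp U.symm.toLinearIsometry, fun y => ?_, fun y => ?_, ?_⟩
  · exact Submodule.mem_orthogonal_singleton_iff_inner_right.1 (U.symm y).2
  · rw [stereoInvFunAux_apply, smul_add]
    exact stereographic'_symm_apply (-p) y
  · change U (stereographic (norm_eq_of_mem_sphere (-p)) p) = 0
    rw [stereographic_neg_apply, map_zero]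

variable {E : Type*} [NormedAddCommGroup E] [InnerProductSpace ℝ E]

/-- The derivative of `stereoInvFunAux v` at `w` in the direction `h`. -/
def stereoDeriv (v w h : E) : E :=
  (-(2 * inner ℝ w h) / (‖w‖ ^ 2 + 4) ^ 2) • ((4 : ℝ) • w + (‖w‖ ^ 2 - 4) • v) +
    (‖w‖ ^ 2 + 4)⁻¹ • ((4 : ℝ) • h + (2 * inner ℝ w h) • v)

theorem fderiv_stereoInvFunAux (v w h : E) :
    fderiv ℝ (stereoInvFunAux v) w h = stereoDeriv v w h := by
  have hs : ‖w‖ ^ 2 + 4 ≠ 0 := by positivity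
  have h0 : HasFDerivAt (fun w : E => ‖w‖ ^ 2) (2 • innerSL ℝ w) w :=
    (hasStrictFDerivAt_norm_sq w).hasFDerivAt
  have h1 := (hasDerivAt_inv hs).comp_hasFDerivAt w (h0.add_const 4)
  have h2 := ((hasFDerivAt_id w).const_smul (4 : ℝ)).add ((h0.sub_const 4).smul_const v)
  have h3 := h1.smul h2
  have h4 : HasFDerivAt (stereoInvFunAux v) _ w := h3
  rw [h4.fderiv]
  simp [stereoDeriv, add_comm, div_eq_inv_mul, mul_comm]

/-- Inverse stereographic projection is conformal; this computes its conformal factor. -/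
theorem inner_stereoDeriv {v w : E} (hv : ‖v‖ = 1) (hw : inner ℝ v w = 0) {h k : E}
    (hh : inner ℝ v h = 0) (hk : inner ℝ v k = 0) :
    inner ℝ (stereoDeriv v w h) (stereoDeriv v w k) =
      16 / (‖w‖ ^ 2 + 4) ^ 2 * inner ℝ h k := by
  have hw' : inner ℝ w v = 0 := by rwa [real_inner_comm]
  have hh' : inner ℝ h v = 0 := by rwa [real_inner_comm]
  have hs : ‖w‖ ^ 2 + 4 ≠ 0 := by positivity
  simp only [stereoDeriv, inner_add_left, inner_add_right, inner_smul_left, inner_smul_right, hw,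
    hw', hh', hk, real_inner_self_eq_norm_sq, hv, RCLike.conj_to_real,
    real_inner_comm w h]
  field_simp
  ring

/-- For unit `v ⊥ h`, the line `t • h` maps to a great circle through `-v`. Its acceleration at `t =
0` is purely normal, equal to `v`. -/
theorem hasDerivAt_stereoDeriv (v : E) {h : E} (hh : ‖h‖ = 1) :
    HasDerivAt (fun t : ℝ => stereoDeriv v (t • h) h) v 0 := by
  have he : (fun t : ℝ => stereoDeriv v (t • h) h) = fun t : ℝ =>
      (-(2 * t) / (t ^ 2 + 4) ^ 2) • ((4 * t) • h + (t ^ 2 - 4) • v) +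
        (t ^ 2 + 4)⁻¹ • ((4 : ℝ) • h + (2 * t) • v) := by
    funext t
    simp [stereoDeriv, inner_smul_left, norm_smul, hh, smul_smul]
  rw [he]
  have e1 : HasDerivAt (fun t : ℝ => -(2 * t) / (t ^ 2 + 4) ^ 2) (-(1 / 8)) 0 := by
    have := (((hasDerivAt_id (0 : ℝ)).const_mul 2).neg).div
      ((((hasDerivAt_id (0 : ℝ)).pow 2).add_const 4).pow 2) (by norm_num)
    refine this.congr_deriv ?_
    norm_num
  have e2 : HasDerivAt (fun t : ℝ => (t ^ 2 + 4)⁻¹) 0 0 := by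
    have := (((hasDerivAt_id (0 : ℝ)).pow 2).add_const 4).inv (by norm_num)
    refine this.congr_deriv ?_
    norm_num
  have e3 : HasDerivAt (fun t : ℝ => (4 * t) • h + (t ^ 2 - 4) • v) ((4 : ℝ) • h) 0 := by
    have := (((hasDerivAt_id (0 : ℝ)).const_mul 4).smul_const h).add
      ((((hasDerivAt_id (0 : ℝ)).pow 2).sub_const 4).smul_const v)
    refine this.congr_deriv ?_
    norm_num
  have e4 : HasDerivAt (fun t : ℝ => (4 : ℝ) • h + (2 * t) • v) ((2 : ℝ) • v) 0 := by
    have := (((hasDerivAt_id (0 : ℝ)).const_mul 2).smul_const v).const_add ((4 : ℝ) • h)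
    refine this.congr_deriv ?_
    norm_num
  refine ((e1.smul e3).add (e2.smul e4)).congr_deriv ?_
  norm_num
  module

end Chart

/-! ### The Laplace–Beltrami operator as a Euclidean Laplacian -/

section Laplacian

variable {E : Type*} [NormedAddCommGroup E] [InnerProductSpace ℝ E]

theorem laplacian_eq_sum [FiniteDimensional ℝ E] {ι : Type*} [Fintype ι] (F : E → ℝ) (b : OrthonormalBasis ι ℝ E) (x : E) :
    Laplacian.laplacian F x = ∑ i, fderiv ℝ (fderiv ℝ F) x (b i) (b i) := by
  simp [InnerProductSpace.laplacian_eq_iteratedFDeriv_orthonormalBasis F b, iteratedFDeriv_two_apply]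

theorem fderiv_apply_self {F : E → ℝ} (hF : ∀ r : ℝ, 0 < r → ∀ x, F (r • x) = F x) {x : E}
    (hd : DifferentiableAt ℝ F x) : fderiv ℝ F x x = 0 := by
  have h1 : HasDerivAt (fun t : ℝ => F (t • x)) (fderiv ℝ F x x) 1 := by
    have h2 : HasDerivAt (fun t : ℝ => t • x) x 1 := by
      simpa using (hasDerivAt_id (1 : ℝ)).smul_const x
    have h3 : HasFDerivAt F (fderiv ℝ F x) ((1 : ℝ) • x) := by rw [one_smul]; exact hd.hasFDerivAt
    exact h3.comp_hasDerivAt 1 h2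
  have h4 : (fun t : ℝ => F (t • x)) =ᶠ[𝓝 1] fun _ => F x := by
    filter_upwards [lt_mem_nhds one_pos] with t ht using hF t ht x
  exact h1.unique ((hasDerivAt_const _ _).congr_of_eventuallyEq h4)

/-- Differentiating Euler's relation `DF(y) y = 0` at `x` in the direction `x` gives `D²F(x)(x, x) +
DF(x) x = 0`, and the last term vanishes. -/
theorem fderiv_fderiv_apply_self {F : E → ℝ} (hF : ∀ r : ℝ, 0 < r → ∀ x, F (r • x) = F x) {x : E}
    (hd : ContDiffAt ℝ 2 F x) : fderiv ℝ (fderiv ℝ F) x x x = 0 := by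
  have h1 : DifferentiableAt ℝ (fderiv ℝ F) x :=
    (hd.fderiv_right (m := 1) (by norm_num)).differentiableAt one_ne_zero
  have h2 : (fun y => fderiv ℝ F y y) =ᶠ[𝓝 x] fun _ => 0 := by
    filter_upwards [hd.eventually (by simp)] with y hy
    exact fderiv_apply_self hF (hy.differentiableAt two_ne_zero)
  have h3 := (h1.hasFDerivAt.clm_apply (hasFDerivAt_id x)).unique
    ((hasFDerivAt_const _ _).congr_of_eventuallyEq h2)
  have h4 := DFunLike.congr_fun h3 x
  simpa [fderiv_apply_self hF (hd.differentiableAt two_ne_zero)] using h4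

theorem laplacian_smul [FiniteDimensional ℝ E] {F : E → ℝ} (hF : ∀ r : ℝ, 0 < r → ∀ x, F (r • x) = F x) {r : ℝ}
    (hr : 0 < r) (x : E) : Laplacian.laplacian F (r • x) = (r ^ 2)⁻¹ * Laplacian.laplacian F x := by
  have h1 (y) : fderiv ℝ F y = r • fderiv ℝ F (r • y) := by
    rw [← fderiv_comp_smul, funext (hF r hr)]
  have h2 : fderiv ℝ (fderiv ℝ F) x = r • r • fderiv ℝ (fderiv ℝ F) (r • x) := by
    rw [← fderiv_comp_smul]
    refine (congrArg (fun G => fderiv ℝ G x) (funext h1)).trans ?_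
    exact congrFun (fderiv_const_smul_field (𝕜 := ℝ) (f := fun y => fderiv ℝ F (r • y)) r) x
  rw [laplacian_eq_sum F (stdOrthonormalBasis ℝ E), laplacian_eq_sum F (stdOrthonormalBasis ℝ E),
    h2]
  simp only [smul_apply, smul_eq_mul, ← Finset.mul_sum]
  field_simp

variable {n : ℕ}

theorem exists_orthonormalBasis_cons {v : Ambient n} (hv1 : ‖v‖ = 1)
    (ι : EuclideanSpace ℝ (Fin n) →ₗᵢ[ℝ] Ambient n) (hι : ∀ y, inner ℝ v (ι y) = 0) :
    ∃ b : OrthonormalBasis (Fin (n + 1)) ℝ (Ambient n), b 0 = v ∧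
      ∀ i : Fin n, b i.succ = ι (EuclideanSpace.single i 1) := by
  let b₀ : Fin (n + 1) → Ambient n := Fin.cons v fun i => ι (EuclideanSpace.single i 1)
  have hb₀ : Orthonormal ℝ b₀ := by
    rw [orthonormal_iff_ite]
    intro i j
    refine Fin.cases ?_ (fun i => ?_) i <;> refine Fin.cases ?_ (fun j => ?_) j
    · simp [b₀, hv1]
    · simp [b₀, hι, (Fin.succ_ne_zero j).symm]
    · simp [b₀, real_inner_comm _ (ι _), hι, Fin.succ_ne_zero]
    · simp [b₀, EuclideanSpace.inner_single_left]
  let b : OrthonormalBasis (Fin (n + 1)) ℝ (Ambient n) :=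
    (basisOfOrthonormalOfCardEqFinrank hb₀ (by simp)).toOrthonormalBasis (by simpa using hb₀)
  have hb (i) : b i = b₀ i := by simp [b]
  exact ⟨b, hb 0, fun i => hb i.succ⟩

/-- The chart at `p` sends `p` to `0`, and there the metric is `16 / (‖y‖² + 4)²` times the
identity. At `0` it is Euclidean and its first derivatives vanish, so only the flat Laplacian
survives. -/
theorem laplaceBeltrami_eq_sum (f : Sph n → ℝ) (p : Sph n)
    (hf : ContDiffAt ℝ 2
      (fun y => f ((chartAt (EuclideanSpace ℝ (Fin n)) p).symm y)) 0) :
    laplaceBeltrami f p = -∑ i, partialDeriv i (partialDeriv i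
      (fun y => f ((chartAt (EuclideanSpace ℝ (Fin n)) p).symm y))) 0 := by
  obtain ⟨ι, hι, he, h0⟩ := exists_chartAt_symm p
  have hp : ‖(-p : Ambient n)‖ = 1 := by simp
  unfold laplaceBeltrami
  rw [h0]
  set e := chartAt (EuclideanSpace ℝ (Fin n)) p
  set s : EuclideanSpace ℝ (Fin n) → ℝ := fun y => ‖y‖ ^ 2 + 4 with hs
  have hs0 (y) : 0 < s y := by positivity
  have hd (i : Fin n) (y) : partialDeriv i (fun y => (e.symm y : Ambient n)) y =
      stereoDeriv (-p : Ambient n) (ι y) (ι (EuclideanSpace.single i 1)) := by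
    unfold partialDeriv
    rw [funext he, ← fderiv_stereoInvFunAux]
    have h1 : DifferentiableAt ℝ (stereoInvFunAux (-p : Ambient n)) (ι y) :=
      (contDiff_stereoInvFunAux (m := 1)).differentiable one_ne_zero _
    have h2 := h1.hasFDerivAt.comp y ι.toContinuousLinearMap.hasFDerivAt
    exact DFunLike.congr_fun h2.fderiv _
  have hm (y) : metricMatrix e y = (16 / s y ^ 2) • (1 : Matrix (Fin n) (Fin n) ℝ) := by
    ext i j
    simp only [metricMatrix, Matrix.of_apply, hd, Matrix.smul_apply, Matrix.one_apply]
    rw [inner_stereoDeriv hp (hι _) (hι _) (hι _), ι.norm_map, ι.inner_map_map]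
    simp [EuclideanSpace.inner_single_left]
    rfl
  have hdet (y) : √(metricMatrix e y).det = (4 / s y) ^ n := by
    rw [hm, Matrix.det_smul, Matrix.det_one, mul_one, Fintype.card_fin,
      show (16 / s y ^ 2) ^ n = ((4 / s y) ^ n) ^ 2 by
        rw [pow_right_comm, div_pow 4 (s y) 2]; norm_num,
      Real.sqrt_sq (by have := hs0 y; positivity)]
  have hinv (y) : (metricMatrix e y)⁻¹ = (s y ^ 2 / 16) • (1 : Matrix (Fin n) (Fin n) ℝ) := by
    have := (hs0 y).ne'
    refine Matrix.inv_eq_left_inv ?_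
    rw [hm, smul_mul_smul_comm, one_mul, div_mul_div_cancel₀' (by positivity), div_self (by norm_num),
      one_smul]
  have hgrad (i : Fin n) (y) : gradInChart e f i y =
      s y ^ 2 / 16 * partialDeriv i (fun y => f (e.symm y)) y := by
    simp [gradInChart, hinv, Matrix.one_apply]
  unfold divInChart
  rw [hdet]
  have hs4 : s 0 = 4 := by simp [hs]
  rw [hs4, div_self (by norm_num : (4 : ℝ) ≠ 0), one_pow, inv_one, one_mul]
  congr 1
  refine Finset.sum_congr rfl fun i _ => ?_
  simp_rw [hdet, hgrad, ← mul_assoc]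
  -- The weight `√det g · g^{ii}` depends only on `‖y‖²`, hence is critical at `0`.
  have hw : HasFDerivAt (fun y => (4 / s y) ^ n * (s y ^ 2 / 16))
      (0 : EuclideanSpace ℝ (Fin n) →L[ℝ] ℝ) 0 := by
    have h1 : HasFDerivAt s (0 : EuclideanSpace ℝ (Fin n) →L[ℝ] ℝ) 0 := by
      refine ((hasStrictFDerivAt_norm_sq (0 : EuclideanSpace ℝ (Fin n))).hasFDerivAt.add_const
        4).congr_fderiv ?_
      simp
    have h2 : DifferentiableAt ℝ (fun t : ℝ => (4 / t) ^ n * (t ^ 2 / 16)) (s 0) := by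
      have := (hs0 0).ne'
      fun_prop (disch := assumption)
    refine (h2.hasDerivAt.comp_hasFDerivAt (0 : EuclideanSpace ℝ (Fin n)) h1).congr_fderiv ?_
    simp
  have hf' : DifferentiableAt ℝ (partialDeriv i fun y => f (e.symm y)) 0 :=
    ((hf.fderiv_right (m := 1) (by norm_num)).differentiableAt one_ne_zero).clm_apply
      (differentiableAt_const _)
  have := (hw.mul hf'.hasFDerivAt).fderiv
  conv_lhs => unfold partialDeriv
  refine (DFunLike.congr_fun this _).trans ?_
  simp [hs4]
  norm_num
  rfl

set_option maxHeartbeats 1000000 in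
/-- The Laplace–Beltrami operator is minus the Laplacian of the `0`-homogeneous extension. -/
theorem laplaceBeltrami_eq_laplacian {F : Ambient n → ℝ}
    (hF : ∀ r : ℝ, 0 < r → ∀ x, F (r • x) = F x) {f : Sph n → ℝ} (hf : ∀ q : Sph n, F q = f q)
    {p : Sph n} (hd : ContDiffAt ℝ 2 F p) :
    laplaceBeltrami f p = -Laplacian.laplacian F p := by
  obtain ⟨ι, hι, he, h0⟩ := exists_chartAt_symm p
  set v : Ambient n := -p with hv
  have hv1 : ‖v‖ = 1 := by simp [hv]
  have hcomp : (fun y => f ((chartAt (EuclideanSpace ℝ (Fin n)) p).symm y)) =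
      fun y => F (stereoInvFunAux v (ι y)) := by
    funext y
    rw [← hf, he]
  have hσ0 : stereoInvFunAux v (ι 0) = p := by simp [stereoInvFunAux, hv, smul_smul]
  have hσ : ContDiff ℝ 2 fun y => stereoInvFunAux v (ι y) :=
    contDiff_stereoInvFunAux.comp ι.contDiff
  have hd' : ContDiffAt ℝ 2 F (stereoInvFunAux v (ι 0)) := hσ0 ▸ hd
  have hFσ : ContDiffAt ℝ 2 (fun y => F (stereoInvFunAux v (ι y))) 0 :=
    hd'.comp (0 : EuclideanSpace ℝ (Fin n)) hσ.contDiffAt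
  rw [laplaceBeltrami_eq_sum f p (hcomp ▸ hFσ), hcomp]
  congr 1
  obtain ⟨b, hb0, hb⟩ := exists_orthonormalBasis_cons hv1 ι hι
  rw [laplacian_eq_sum F b, Fin.sum_univ_succ]
  simp only [hb0, hb]
  -- By homogeneity the normal direction contributes nothing; the remaining basis vectors are the
  -- coordinate tangent vectors at `p`.
  have hvv : fderiv ℝ (fderiv ℝ F) p v v = 0 := by
    simpa [hv] using fderiv_fderiv_apply_self hF hd
  rw [hvv, zero_add]
  refine Finset.sum_congr rfl fun i _ => ?_
  set h : Ambient n := ι (EuclideanSpace.single i 1) with hh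
  have hh1 : ‖h‖ = 1 := by simp [hh]
  -- compute both derivatives along the line through `0` in the direction of the `i`-th axis
  have hγ0 : HasDerivAt (fun t : ℝ => t • EuclideanSpace.single i (1 : ℝ))
      (EuclideanSpace.single i 1) 0 := by
    simpa using (hasDerivAt_id (0 : ℝ)).smul_const (EuclideanSpace.single i (1 : ℝ))
  have hdiff : DifferentiableAt ℝ (partialDeriv i fun y => F (stereoInvFunAux v (ι y)))
      ((0 : ℝ) • EuclideanSpace.single i 1) := by
    rw [zero_smul]
    exact ((hFσ.fderiv_right (m := 1) (by norm_num)).differentiableAt one_ne_zero).clm_apply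
      (differentiableAt_const _)
  have h1 := hdiff.hasFDerivAt.comp_hasDerivAt (0 : ℝ) hγ0
  rw [zero_smul] at h1
  have hσd (w : Ambient n) : HasFDerivAt (stereoInvFunAux v) (fderiv ℝ (stereoInvFunAux v) w) w :=
    ((contDiff_stereoInvFunAux (m := 1)).differentiable one_ne_zero _).hasFDerivAt
  have h2 : (partialDeriv i fun y => F (stereoInvFunAux v (ι y))) ∘
      (fun t : ℝ => t • EuclideanSpace.single i (1 : ℝ)) =ᶠ[𝓝 0]
      fun t => fderiv ℝ F (stereoInvFunAux v (t • h)) (stereoDeriv v (t • h) h) := by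
    have h3 : ∀ᶠ y in 𝓝 (0 : EuclideanSpace ℝ (Fin n)),
        ContDiffAt ℝ 2 F (stereoInvFunAux v (ι y)) :=
      hσ.continuous.continuousAt.eventually (hd'.eventually (by simp))
    have h4 : Tendsto (fun t : ℝ => t • EuclideanSpace.single i (1 : ℝ)) (𝓝 0) (𝓝 0) := by
      simpa using hγ0.continuousAt.tendsto
    filter_upwards [h4.eventually h3] with t ht
    have h5 := (ht.differentiableAt two_ne_zero).hasFDerivAt.comp (t • EuclideanSpace.single i (1 : ℝ))
      ((hσd (ι (t • EuclideanSpace.single i 1))).comp (t • EuclideanSpace.single i (1 : ℝ))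
        ι.toContinuousLinearMap.hasFDerivAt)
    refine (DFunLike.congr_fun h5.fderiv _).trans ?_
    rw [← fderiv_stereoInvFunAux, hh, ← map_smul]
    rfl
  have hτ0 : stereoDeriv v ((0 : ℝ) • h) h = h := by simp [stereoDeriv, smul_smul]
  have hγ : HasDerivAt (fun t : ℝ => stereoInvFunAux v (t • h)) h 0 := by
    have h3 : HasDerivAt (fun t : ℝ => t • h) h 0 := by
      simpa using (hasDerivAt_id (0 : ℝ)).smul_const h
    have h4 := (hσd _).comp_hasDerivAt (0 : ℝ) h3
    rwa [fderiv_stereoInvFunAux, hτ0] at h4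
  have hσ0' : stereoInvFunAux v ((0 : ℝ) • h) = p := by simpa using hσ0
  have h6 : HasFDerivAt (fderiv ℝ F) (fderiv ℝ (fderiv ℝ F) p)
      (stereoInvFunAux v ((0 : ℝ) • h)) := by
    rw [hσ0']
    exact ((hd.fderiv_right (m := 1) (by norm_num)).differentiableAt one_ne_zero).hasFDerivAt
  have h7 := (h6.comp_hasDerivAt (0 : ℝ) hγ).clm_apply (hasDerivAt_stereoDeriv v hh1)
  have h8 := h1.unique (h7.congr_of_eventuallyEq h2)
  refine h8.trans ?_
  -- The acceleration of the curve is `-p`, and `DF(p) p = 0` removes its contribution.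
  rw [hτ0, Function.comp_apply, hσ0', hv, map_neg,
    fderiv_apply_self hF (hd.differentiableAt two_ne_zero), neg_zero, add_zero]

end Laplacian

/-! ### Green's identity in Euclidean space and polar coordinates -/

section Divergence

variable {E : Type*} [NormedAddCommGroup E] [InnerProductSpace ℝ E] [FiniteDimensional ℝ E]
  [MeasurableSpace E] [BorelSpace E]

theorem integral_fderiv_apply_eq_zero (μ : Measure E) [μ.IsAddHaarMeasure] {W : E → ℝ}
    (hW : ContDiff ℝ 1 W) (hc : HasCompactSupport W) (v : E) : ∫ x, fderiv ℝ W x v ∂μ = 0 := by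
  have h1 : Continuous fun x => fderiv ℝ W x v :=
    (hW.continuous_fderiv one_ne_zero).clm_apply continuous_const
  have h2 : HasCompactSupport fun x => fderiv ℝ W x v := hc.fderiv_apply ℝ v
  have := integral_mul_fderiv_eq_neg_fderiv_mul_of_integrable (μ := μ) (𝕜 := ℝ) (f := fun _ => 1)
    (g := W) (v := v) (by simp) (by simpa using h1.integrable_of_hasCompactSupport h2)
    (by simpa using hW.continuous.integrable_of_hasCompactSupport hc)
    (fun x _ => differentiableAt_const _) fun x _ => hW.differentiable one_ne_zero x
  simpa using this

/-- Green's second identity for `0`-homogeneous functions and a radial cut-off. -/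
theorem integral_cutoff_mul_laplacian (μ : Measure E) [μ.IsAddHaarMeasure] {F H η : E → ℝ}
    (hF : ∀ r : ℝ, 0 < r → ∀ x, F (r • x) = F x) (hFd : ∀ x, x ≠ 0 → ContDiffAt ℝ 2 F x)
    (hH : ∀ r : ℝ, 0 < r → ∀ x, H (r • x) = H x) (hHd : ∀ x, x ≠ 0 → ContDiffAt ℝ 2 H x)
    (hη : ContDiff ℝ 1 η) (hc : HasCompactSupport η) (h0 : η =ᶠ[𝓝 0] 0)
    (hrad : ∀ x, ∃ c : ℝ, ∀ v, fderiv ℝ η x v = c * inner ℝ x v) :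
    ∫ x, η x * (H x * Laplacian.laplacian F x - F x * Laplacian.laplacian H x) ∂μ = 0 := by
  let b := stdOrthonormalBasis ℝ E
  -- The components of `η (H ∇F - F ∇H)`; the divergence of this compactly supported field
  -- integrates to zero.
  let W (v : E) : E → ℝ := fun x => η x * (H x * fderiv ℝ F x v - F x * fderiv ℝ H x v)
  have hFd' (x) (hx : x ≠ 0) (v) : ContDiffAt ℝ 1 (fun x => fderiv ℝ F x v) x :=
    ((hFd x hx).fderiv_right (m := 1) (by norm_num)).clm_apply contDiffAt_const
  have hHd' (x) (hx : x ≠ 0) (v) : ContDiffAt ℝ 1 (fun x => fderiv ℝ H x v) x :=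
    ((hHd x hx).fderiv_right (m := 1) (by norm_num)).clm_apply contDiffAt_const
  have hW0 (v) : W v =ᶠ[𝓝 0] 0 := by
    filter_upwards [h0] with x hx
    simp [W, hx]
  have hW (v) : ContDiff ℝ 1 (W v) := by
    refine contDiff_iff_contDiffAt.2 fun x => ?_
    rcases eq_or_ne x 0 with rfl | hx
    · exact (contDiffAt_const (c := (0 : ℝ))).congr_of_eventuallyEq (hW0 v)
    · exact hη.contDiffAt.mul ((((hHd x hx).of_le one_le_two).mul (hFd' x hx v)).sub
        (((hFd x hx).of_le one_le_two).mul (hHd' x hx v)))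
  have hWc (v) : HasCompactSupport (W v) := hc.mul_right
  have hWd (x v) : fderiv ℝ (W v) x v =
      η x * (H x * fderiv ℝ (fderiv ℝ F) x v v - F x * fderiv ℝ (fderiv ℝ H) x v v) +
        fderiv ℝ η x v * (H x * fderiv ℝ F x v - F x * fderiv ℝ H x v) := by
    rcases eq_or_ne x 0 with rfl | hx
    · rw [(hW0 v).fderiv_eq, h0.fderiv_eq, h0.self_of_nhds]
      simp
    · have e1 := (hη.differentiable one_ne_zero x).hasFDerivAt
      have e2 := ((hFd x hx).differentiableAt two_ne_zero).hasFDerivAt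
      have e3 := ((hHd x hx).differentiableAt two_ne_zero).hasFDerivAt
      have e4 := (((hFd x hx).fderiv_right (m := 1) (by norm_num)).differentiableAt
        one_ne_zero).hasFDerivAt.clm_apply (hasFDerivAt_const v x)
      have e5 := (((hHd x hx).fderiv_right (m := 1) (by norm_num)).differentiableAt
        one_ne_zero).hasFDerivAt.clm_apply (hasFDerivAt_const v x)
      have e6 : HasFDerivAt (W v) _ x := e1.mul ((e3.mul e4).sub (e2.mul e5))
      rw [e6.fderiv]
      simp
      ring
  have hsum (x) : ∑ i, fderiv ℝ (W (b i)) x (b i) =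
      η x * (H x * Laplacian.laplacian F x - F x * Laplacian.laplacian H x) := by
    simp_rw [hWd, laplacian_eq_sum _ b]
    rw [Finset.sum_add_distrib, ← Finset.mul_sum, Finset.sum_sub_distrib, ← Finset.mul_sum,
      ← Finset.mul_sum]
    rcases eq_or_ne x 0 with rfl | hx
    · rw [h0.fderiv_eq]
      simp
    obtain ⟨c, hc⟩ := hrad x
    have hb (A : E →L[ℝ] ℝ) : ∑ i, inner ℝ x (b i) * A (b i) = A x := by
      conv_rhs => rw [← b.sum_repr x]
      simp [b.repr_apply_apply, real_inner_comm]
    -- The gradient of `η` is radial, so the cut-off term only sees the radial derivatives of `F`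
    -- and `H`, which vanish.
    have h1 : ∑ i, fderiv ℝ η x (b i) * (H x * fderiv ℝ F x (b i) - F x * fderiv ℝ H x (b i)) =
        c * (H x * ∑ i, inner ℝ x (b i) * fderiv ℝ F x (b i) -
          F x * ∑ i, inner ℝ x (b i) * fderiv ℝ H x (b i)) := by
      simp only [hc, Finset.mul_sum, ← Finset.sum_sub_distrib]
      exact Finset.sum_congr rfl fun i _ => by ring
    rw [h1, hb, hb, fderiv_apply_self hF ((hFd x hx).differentiableAt two_ne_zero),
      fderiv_apply_self hH ((hHd x hx).differentiableAt two_ne_zero)]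
    simp
  simp_rw [← hsum]
  rw [integral_finsetSum]
  · exact Finset.sum_eq_zero fun i _ => integral_fderiv_apply_eq_zero μ (hW _) (hWc _) _
  · intro i _
    exact (((hW _).continuous_fderiv one_ne_zero).clm_apply
      continuous_const).integrable_of_hasCompactSupport ((hWc _).fderiv_apply ℝ _)

/-- Polar coordinates separate the radial factor. The constant `A` does not depend on `K`, so its
nonvanishing can be tested on a convenient `K`. -/
theorem exists_integral_radial_mul (μ : Measure E) [μ.IsAddHaarMeasure] (χ : ℝ → ℝ) :
    ∃ A : ℝ, ∀ K : E → ℝ, (∀ r : ℝ, 0 < r → ∀ x, K (r • x) = (r ^ 2)⁻¹ * K x) →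
      ∫ x, χ (‖x‖ ^ 2) * K x ∂μ = A * ∫ q : sphere (0 : E) 1, K q ∂μ.toSphere := by
  refine ⟨∫ r : Ioi (0 : ℝ), χ (r.1 ^ 2) * (r.1 ^ 2)⁻¹
    ∂(Measure.volumeIoiPow (Module.finrank ℝ E - 1)), fun K hK => ?_⟩
  rcases subsingleton_or_nontrivial E with hE | hE
  · have : IsEmpty (sphere (0 : E) 1) :=
      ⟨fun q => by simpa [Subsingleton.elim (q : E) 0] using norm_eq_of_mem_sphere q⟩
    have h2 : K 0 = 0 := by
      have := hK 2 two_pos 0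
      rw [smul_zero] at this
      linarith
    simp [integral_of_isEmpty, Subsingleton.elim _ (0 : E), h2]
  rw [mul_comm, ← integral_prod_mul (fun q : sphere (0 : E) 1 => K q),
    ← μ.measurePreserving_homeomorphUnitSphereProd.integral_comp
      (Homeomorph.measurableEmbedding _)]
  calc ∫ x, χ (‖x‖ ^ 2) * K x ∂μ
      = ∫ x : ({(0)}ᶜ : Set E), χ (‖x.1‖ ^ 2) * K x ∂(μ.comap (↑)) := by
        rw [integral_subtype_comap (measurableSet_singleton _).compl
          fun x => χ (‖x‖ ^ 2) * K x, restrict_compl_singleton]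
    _ = _ := by
        refine integral_congr_ae (ae_of_all _ fun x => ?_)
        have hx : 0 < ‖(x : E)‖ := norm_pos_iff.2 x.2
        have h1 := hK ‖(x : E)‖⁻¹ (inv_pos.2 hx) x
        simp only [homeomorphUnitSphereProd_apply_fst_coe, homeomorphUnitSphereProd_apply_snd_coe,
          h1]
        field_simp

end Divergence

/-! ### Homogeneous extension and symmetry of the Laplacian -/

section Sphere

variable {n : ℕ}

theorem norm_inv_smul_mem_sphere {E : Type*} [NormedAddCommGroup E] [NormedSpace ℝ E] {x : E}
    (hx : x ≠ 0) : ‖x‖⁻¹ • x ∈ sphere (0 : E) 1 := by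
  simp [norm_smul, hx]

/-- The extension of a function on the sphere to a `0`-homogeneous function. -/
def radialExt (f : Sph n → ℝ) (x : Ambient n) : ℝ :=
  if hx : x = 0 then 0 else f ⟨‖x‖⁻¹ • x, norm_inv_smul_mem_sphere hx⟩

theorem radialExt_coe (f : Sph n → ℝ) (q : Sph n) : radialExt f q = f q := by
  have hq : (q : Ambient n) ≠ 0 := ne_zero_of_mem_unit_sphere q
  simp [radialExt, hq]

theorem radialExt_smul (f : Sph n → ℝ) {r : ℝ} (hr : 0 < r) (x : Ambient n) :
    radialExt f (r • x) = radialExt f x := by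
  by_cases hx : x = 0
  · simp [hx]
  · simp only [radialExt, hx, smul_eq_zero, hr.ne', or_self, dite_false]
    congr 2
    rw [norm_smul, Real.norm_of_nonneg hr.le, smul_smul]
    field_simp

theorem contDiffAt_radialExt {f : Sph n → ℝ} (hf : ContMDiff (𝓡 n) 𝓘(ℝ, ℝ) ∞ f) {x : Ambient n}
    (hx : x ≠ 0) : ContDiffAt ℝ ∞ (radialExt f) x := by
  have := Fact.mk (@finrank_euclideanSpace_fin ℝ _ (n + 1))
  let U : TopologicalSpace.Opens (Ambient n) := ⟨{0}ᶜ, isOpen_compl_singleton⟩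
  have h1 : ContMDiff 𝓘(ℝ, Ambient n) 𝓘(ℝ, Ambient n) ∞ fun y : U => ‖(y : Ambient n)‖⁻¹ •
      (y : Ambient n) := fun y => by
    refine (contMDiffAt_subtype_iff (f := fun z : Ambient n => ‖z‖⁻¹ • z)).2 ?_
    have hy : (y : Ambient n) ≠ 0 := y.2
    exact (((contDiffAt_norm ℝ hy).inv (norm_ne_zero_iff.2 hy)).smul contDiffAt_id).contMDiffAt
  have h2 := hf.comp (h1.codRestrict_sphere fun y => norm_inv_smul_mem_sphere y.2)
  rw [← contMDiffAt_iff_contDiffAt]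
  refine (contMDiffAt_subtype_iff (U := U) (x := ⟨x, hx⟩)).1 ?_
  refine (h2 ⟨x, hx⟩).congr_of_eventuallyEq (Eventually.of_forall fun y => ?_)
  have hy : (y : Ambient n) ≠ 0 := y.2
  simp only [radialExt, hy, dite_false]
  rfl

theorem contDiffAt_two_radialExt {f : Sph n → ℝ} (hf : ContMDiff (𝓡 n) 𝓘(ℝ, ℝ) ∞ f)
    {x : Ambient n} (hx : x ≠ 0) : ContDiffAt ℝ 2 (radialExt f) x :=
  (contDiffAt_radialExt hf hx).of_le ENat.LEInfty.out

theorem laplaceBeltrami_eq_laplacian_radialExt {f : Sph n → ℝ}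
    (hf : ContMDiff (𝓡 n) 𝓘(ℝ, ℝ) ∞ f) (p : Sph n) :
    laplaceBeltrami f p = -Laplacian.laplacian (radialExt f) p :=
  laplaceBeltrami_eq_laplacian (fun _ hr x => radialExt_smul f hr x) (radialExt_coe f)
    (contDiffAt_two_radialExt hf (ne_zero_of_mem_unit_sphere p))

theorem continuous_laplaceBeltrami {f : Sph n → ℝ} (hf : ContMDiff (𝓡 n) 𝓘(ℝ, ℝ) ∞ f) :
    Continuous (laplaceBeltrami f) := by
  rw [funext (laplaceBeltrami_eq_laplacian_radialExt hf)]
  refine (continuous_iff_continuousAt.2 fun p => ?_).neg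
  have hp : (p : Ambient n) ≠ 0 := ne_zero_of_mem_unit_sphere p
  have h1 : ContinuousAt (Laplacian.laplacian (radialExt f)) (p : Ambient n) := by
    rw [funext (laplacian_eq_sum (radialExt f) (stdOrthonormalBasis ℝ (Ambient n)))]
    have h2 : ContinuousAt (fderiv ℝ (fderiv ℝ (radialExt f))) (p : Ambient n) :=
      (((contDiffAt_two_radialExt hf hp).fderiv_right (m := 1) (by norm_num)).fderiv_right
        (m := 0) (by norm_num)).continuousAt
    exact tendsto_finsetSum _ fun i _ => (h2.clm_apply continuousAt_const).clm_apply
      continuousAt_const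
  exact h1.comp continuous_subtype_val.continuousAt

/-- The Laplace–Beltrami operator is symmetric. -/
theorem integral_mul_laplaceBeltrami_comm {f h : Sph n → ℝ} (hf : ContMDiff (𝓡 n) 𝓘(ℝ, ℝ) ∞ f)
    (hh : ContMDiff (𝓡 n) 𝓘(ℝ, ℝ) ∞ h) :
    ∫ q, h q * laplaceBeltrami f q ∂(vol n) = ∫ q, f q * laplaceBeltrami h q ∂(vol n) := by
  -- As a function of `‖x‖²`, this bump is `1` on the sphere and vanishes near the origin, where the
  -- extensions are singular.
  let χ : ContDiffBump (1 : ℝ) := ⟨1 / 4, 1 / 2, by norm_num, by norm_num⟩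
  let η : Ambient n → ℝ := fun x => χ (‖x‖ ^ 2)
  have hχ : ContDiff ℝ 1 χ := χ.contDiff
  have hη : ContDiff ℝ 1 η := hχ.comp (contDiff_norm_sq ℝ)
  have hη0 (x : Ambient n) (hx : ‖x‖ ^ 2 ≤ 1 / 2) : η x = 0 := by
    refine χ.zero_of_le_dist ?_
    rw [Real.dist_eq, abs_of_nonpos (by linarith)]
    change 1 / 2 ≤ _
    linarith
  have hc : HasCompactSupport η := by
    refine HasCompactSupport.intro (isCompact_closedBall (0 : Ambient n) 2) fun x hx => ?_
    refine χ.zero_of_le_dist ?_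
    have : 2 < ‖x‖ := by simpa using hx
    rw [Real.dist_eq, abs_of_nonneg (by nlinarith)]
    change 1 / 2 ≤ _
    nlinarith
  have h0 : η =ᶠ[𝓝 0] 0 := by
    filter_upwards [ball_mem_nhds (0 : Ambient n) (by norm_num : (0 : ℝ) < 1 / 2)] with x hx
    rw [mem_ball_zero_iff] at hx
    exact hη0 x (by nlinarith [norm_nonneg x])
  have hrad (x : Ambient n) : ∃ c : ℝ, ∀ v, fderiv ℝ η x v = c * inner ℝ x v := by
    have h1 := (hχ.differentiable one_ne_zero (‖x‖ ^ 2)).hasDerivAt.comp_hasFDerivAt x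
      (hasStrictFDerivAt_norm_sq x).hasFDerivAt
    refine ⟨deriv χ (‖x‖ ^ 2) * 2, fun v => ?_⟩
    refine (DFunLike.congr_fun h1.fderiv v).trans ?_
    simp [mul_assoc]
  obtain ⟨A, hA⟩ := exists_integral_radial_mul (volume : Measure (Ambient n)) χ
  have hA0 : A ≠ 0 := by
    rintro rfl
    -- If `A = 0`, the choice `K = ‖x‖⁻²` makes a nonnegative continuous function, positive on the
    -- sphere, integrate to zero.
    have h1 := hA (fun x => (‖x‖ ^ 2)⁻¹) fun r hr x => by
      rw [norm_smul, Real.norm_of_nonneg hr.le, mul_pow, mul_inv]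
    rw [zero_mul] at h1
    have h2 : Continuous fun x : Ambient n => χ (‖x‖ ^ 2) * (‖x‖ ^ 2)⁻¹ := by
      refine continuous_iff_continuousAt.2 fun x => ?_
      rcases eq_or_ne x 0 with rfl | hx
      · refine (continuousAt_const (y := (0 : ℝ))).congr ?_
        filter_upwards [h0] with x hx
        have hx' : χ (‖x‖ ^ 2) = 0 := hx
        rw [hx', zero_mul]
      · exact hη.continuous.continuousAt.mul (by fun_prop (disch := simpa using hx))
    let q : Sph n := ⟨EuclideanSpace.single 0 1, by simp⟩
    have h3 := h2.integral_pos_of_hasCompactSupport_nonneg_nonzero (μ := volume) (x := (q : Ambient n))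
      hc.mul_right (fun x => mul_nonneg χ.nonneg (by positivity)) (by
        have : χ 1 = 1 := χ.one_of_mem_closedBall (mem_closedBall_self χ.rIn_pos.le)
        simp [this])
    exact h3.ne' h1
  have hint (f h : Sph n → ℝ) (hf : ContMDiff (𝓡 n) 𝓘(ℝ, ℝ) ∞ f)
      (hh : ContMDiff (𝓡 n) 𝓘(ℝ, ℝ) ∞ h) :
      Integrable (fun q => h q * laplaceBeltrami f q) (vol n) :=
    (hh.continuous.mul (continuous_laplaceBeltrami hf)).integrable_of_hasCompactSupport
      (HasCompactSupport.of_compactSpace _)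
  have key := integral_cutoff_mul_laplacian (volume : Measure (Ambient n))
    (fun _ hr x => radialExt_smul f hr x) (fun _ hx => contDiffAt_two_radialExt hf hx)
    (fun _ hr x => radialExt_smul h hr x) (fun _ hx => contDiffAt_two_radialExt hh hx) hη hc h0 hrad
  rw [hA _ fun r hr x => by
    rw [radialExt_smul f hr, radialExt_smul h hr,
      laplacian_smul (fun _ hr x => radialExt_smul f hr x) hr,
      laplacian_smul (fun _ hr x => radialExt_smul h hr x) hr]
    ring] at key
  have h4 := (mul_eq_zero.1 key).resolve_left hA0
  rw [← sub_eq_zero, ← integral_sub (hint f h hf hh) (hint h f hh hf), ← neg_eq_zero,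
    ← integral_neg, ← h4]
  refine integral_congr_ae (ae_of_all _ fun q => ?_)
  simp only [laplaceBeltrami_eq_laplacian_radialExt hf, laplaceBeltrami_eq_laplacian_radialExt hh,
    radialExt_coe]
  ring

end Sphere

/-! ### Zonal functions and the Laplacian of their powers -/

section Zonal

variable {n : ℕ}

/-- The zonal function `q ↦ (1 + ⟪p, q⟫) / 2 = 1 - ‖p - q‖ ^ 2 / 4`. -/
def zonal (p q : Sph n) : ℝ := (1 + inner ℝ (p : Ambient n) (q : Ambient n)) / 2

theorem zonal_eq (p q : Sph n) :
    zonal p q = 1 - ‖(p : Ambient n) - (q : Ambient n)‖ ^ 2 / 4 := by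
  rw [norm_sub_sq_real, norm_eq_of_mem_sphere, norm_eq_of_mem_sphere, zonal]
  ring

theorem zonal_comm (p q : Sph n) : zonal p q = zonal q p := by
  rw [zonal, zonal, real_inner_comm]

theorem zonal_self (p : Sph n) : zonal p p = 1 := by simp [zonal_eq]

theorem zonal_lt_one {p q : Sph n} (h : p ≠ q) : zonal p q < 1 := by
  have : 0 < ‖(p : Ambient n) - (q : Ambient n)‖ :=
    norm_pos_iff.2 (sub_ne_zero.2 fun e => h (Subtype.ext e))
  rw [zonal_eq]
  nlinarith

theorem zonal_nonneg (p q : Sph n) : 0 ≤ zonal p q := by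
  have h : ‖(p : Ambient n) - (q : Ambient n)‖ ≤ 1 + 1 := by
    simpa using norm_sub_le (p : Ambient n) (q : Ambient n)
  rw [zonal_eq]
  nlinarith [norm_nonneg ((p : Ambient n) - (q : Ambient n))]

theorem continuous_zonal : Continuous fun x : Sph n × Sph n => zonal x.1 x.2 := by
  unfold zonal
  fun_prop

theorem contMDiff_zonal_pow (p : Sph n) (m : ℕ) :
    ContMDiff (𝓡 n) 𝓘(ℝ, ℝ) ∞ fun q => zonal p q ^ m := by
  have := Fact.mk (@finrank_euclideanSpace_fin ℝ _ (n + 1))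
  have h : ContDiff ℝ ∞ fun x : Ambient n => ((1 + inner ℝ (p : Ambient n) x) / 2) ^ m := by
    have h1 : ContDiff ℝ ∞ fun x : Ambient n => inner ℝ (p : Ambient n) x :=
      contDiff_const.inner ℝ contDiff_id
    fun_prop
  exact h.contMDiff.comp contMDiff_coe_sphere

theorem partialDeriv_partialDeriv {i : Fin n} {G : EuclideanSpace ℝ (Fin n) → ℝ}
    (hG : ContDiff ℝ 2 G) {g' : ℝ → ℝ} {c : ℝ}
    (h1 : ∀ t, HasDerivAt (fun t : ℝ => G (t • EuclideanSpace.single i 1)) (g' t) t)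
    (h2 : HasDerivAt g' c 0) : partialDeriv i (partialDeriv i G) 0 = c := by
  have hl (t : ℝ) : HasDerivAt (fun t : ℝ => t • EuclideanSpace.single i (1 : ℝ))
      (EuclideanSpace.single i 1) t := by
    simpa using (hasDerivAt_id t).smul_const (EuclideanSpace.single i (1 : ℝ))
  have h3 : (partialDeriv i G) ∘ (fun t : ℝ => t • EuclideanSpace.single i (1 : ℝ)) = g' := by
    funext t
    exact ((hG.differentiable two_ne_zero _).hasFDerivAt.comp_hasDerivAt t (hl t)).unique (h1 t)
  have h4 : Differentiable ℝ (partialDeriv i G) := fun y =>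
    ((hG.fderiv_right (m := 1) (by norm_num)).differentiable one_ne_zero y).clm_apply
      (differentiableAt_const _)
  have h5 := (h4 _).hasFDerivAt.comp_hasDerivAt (0 : ℝ) (hl 0)
  rw [h3, zero_smul] at h5
  exact h5.unique h2

/-- Along the `i`-th axis of the chart at `q`, `zonal p` is a rational function of `t` with value
`x`, first derivative `β i / 2` and second derivative `-u / 2` at `0`, where `u = 2x - 1`. Summing
over `i` uses `∑ (β i)² = 1 - u² = 4x(1 - x)`. -/
theorem laplaceBeltrami_zonal_pow_succ (p q : Sph n) (m : ℕ) :
    laplaceBeltrami (fun q => zonal p q ^ (m + 1)) q =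
      (m + 1) * ((m + n) * zonal p q ^ (m + 1) - (m + n / 2) * zonal p q ^ m) := by
  obtain ⟨ι, hι, he, h0⟩ := exists_chartAt_symm q
  set v : Ambient n := -q with hv
  have hv1 : ‖v‖ = 1 := by simp [hv]
  obtain ⟨b, hb0, hb⟩ := exists_orthonormalBasis_cons hv1 ι hι
  set u : ℝ := inner ℝ (p : Ambient n) (q : Ambient n) with hu
  let G : EuclideanSpace ℝ (Fin n) → ℝ := fun y =>
    zonal p ((chartAt (EuclideanSpace ℝ (Fin n)) q).symm y) ^ (m + 1)
  have hGe (y) : G y = ((1 - u + (‖y‖ ^ 2 + 4)⁻¹ *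
      (4 * inner ℝ (p : Ambient n) (ι y) + 8 * u)) / 2) ^ (m + 1) := by
    have : ‖y‖ ^ 2 + 4 ≠ 0 := by positivity
    simp only [G, zonal, he, stereoInvFunAux, inner_smul_right, inner_add_right, hv,
      inner_neg_right, ← hu, ι.norm_map]
    congr 2
    field_simp
    ring
  have hG : ContDiff ℝ 2 G := by
    rw [funext hGe]
    have h1 : ContDiff ℝ 2 fun y : EuclideanSpace ℝ (Fin n) => (‖y‖ ^ 2 + 4)⁻¹ :=
      ((contDiff_norm_sq ℝ).add contDiff_const).inv fun y => by positivity
    have h2 : ContDiff ℝ 2 fun y => inner ℝ (p : Ambient n) (ι y) :=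
      contDiff_const.inner ℝ ι.contDiff
    fun_prop
  rw [laplaceBeltrami_eq_sum _ _ hG.contDiffAt]
  set β : Fin n → ℝ := fun i => inner ℝ (p : Ambient n) (ι (EuclideanSpace.single i 1)) with hβ
  set x := zonal p q with hx
  have hxu : x = (1 + u) / 2 := rfl
  have key (i : Fin n) : partialDeriv i (partialDeriv i G) 0 =
      (m + 1) * ((m * x ^ (m - 1)) * (β i / 2) ^ 2 + x ^ m * (-u / 2)) := by
    let X : ℝ → ℝ := fun t => (1 - u + (t ^ 2 + 4)⁻¹ * (4 * (t * β i) + 8 * u)) / 2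
    let X' : ℝ → ℝ := fun t => (8 * β i - 8 * u * t - 2 * β i * t ^ 2) / (t ^ 2 + 4) ^ 2
    have hX (t : ℝ) : HasDerivAt X (X' t) t := by
      have ht : t ^ 2 + 4 ≠ 0 := by positivity
      have := (((((((hasDerivAt_id t).pow 2).add_const 4).inv ht).mul
        ((((hasDerivAt_id t).mul_const (β i)).const_mul 4).add_const (8 * u))).const_add
        (1 - u)).div_const 2)
      refine this.congr_deriv ?_
      simp only [X', id, Pi.pow_apply, Pi.inv_apply]
      field_simp
      ring
    have hX' : HasDerivAt X' (-u / 2) 0 := by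
      have := (((((hasDerivAt_id (0 : ℝ)).const_mul (8 * u)).const_sub (8 * β i)).sub
        (((hasDerivAt_id (0 : ℝ)).pow 2).const_mul (2 * β i))).div
        ((((hasDerivAt_id (0 : ℝ)).pow 2).add_const 4).pow 2) (by norm_num))
      refine this.congr_deriv ?_
      norm_num
      ring
    have hX0 : X 0 = x := by simp only [X, hxu]; norm_num; ring
    have hX'0 : X' 0 = β i / 2 := by simp only [X']; norm_num; ring
    refine partialDeriv_partialDeriv hG (g' := fun t => ((m + 1 : ℕ) : ℝ) * X t ^ m * X' t)
      (fun t => ?_) ?_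
    · have h1 : (fun t : ℝ => G (t • EuclideanSpace.single i 1)) = fun t => X t ^ (m + 1) := by
        funext t
        rw [hGe, map_smul, inner_smul_right, norm_smul]
        simp [X, hβ]
      rw [h1]
      exact (hX t).pow (m + 1)
    · have h1 := (((hX 0).pow m).const_mul ((m + 1 : ℕ) : ℝ)).mul hX'
      refine h1.congr_deriv ?_
      simp only [hX0, hX'0, Pi.pow_apply]
      push_cast
      ring
  -- Parseval for the unit vector `p` in the basis formed by `-q` and the tangent vectors at `q`.
  have hsum : ∑ i, β i ^ 2 = 1 - u ^ 2 := by
    have h1 := b.sum_sq_inner_left (p : Ambient n)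
    rw [Fin.sum_univ_succ] at h1
    simp only [hb0, hb, hv, inner_neg_right, ← hu] at h1
    rw [norm_eq_of_mem_sphere] at h1
    simp only [hβ]
    linarith
  change -∑ i, partialDeriv i (partialDeriv i G) 0 = _
  simp_rw [key]
  rw [← Finset.mul_sum, Finset.sum_add_distrib, ← Finset.mul_sum]
  simp_rw [div_pow]
  rw [← Finset.sum_div, hsum, Finset.sum_const, Finset.card_univ, Fintype.card_fin, nsmul_eq_mul]
  have hu' : u = 2 * x - 1 := by rw [hxu]; ring
  -- For `m = 0` the truncated exponent is harmless, because of the factor `m`.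
  have hm : (m : ℝ) * x ^ (m - 1) * x = m * x ^ m := by
    cases m with
    | zero => simp
    | succ k => rw [Nat.add_sub_cancel, mul_assoc, ← pow_succ]
  rw [hu', pow_succ]
  linear_combination (-(m + 1) * (1 - x)) * hm

end Zonal

/-! ### Approximate identity, existence and uniqueness -/

section Green

variable {n : ℕ}

theorem integrable_of_continuous {f : Sph n → ℝ} (hf : Continuous f) : Integrable f (vol n) :=
  hf.integrable_of_hasCompactSupport (HasCompactSupport.of_compactSpace _)

theorem continuous_zonal_right (p : Sph n) : Continuous (zonal p) :=
  continuous_zonal.comp (Continuous.prodMk_right p)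

theorem continuous_zonal_pow (p : Sph n) (m : ℕ) : Continuous fun q => zonal p q ^ m :=
  (continuous_zonal_right p).pow m

/-- The cone over a point lies in a line, a proper subspace since `n + 1 ≥ 2`. -/
theorem vol_singleton (hn : 1 ≤ n) (p : Sph n) : vol n {p} = 0 := by
  rw [Measure.toSphere_apply' _ (measurableSet_singleton p)]
  refine mul_eq_zero_of_right _ (measure_mono_null ?_
    (Measure.addHaar_submodule volume (Submodule.span ℝ {(p : Ambient n)}) fun h => ?_))
  · rintro _ ⟨r, -, _, ⟨q, rfl, rfl⟩, rfl⟩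
    exact Submodule.smul_mem _ _ (Submodule.mem_span_singleton_self _)
  · have h1 := finrank_span_singleton (K := ℝ) (ne_zero_of_mem_unit_sphere p)
    rw [h, finrank_top, finrank_euclideanSpace, Fintype.card_fin] at h1
    omega

theorem ae_ne (hn : 1 ≤ n) (p : Sph n) : ∀ᵐ q ∂(vol n), p ≠ q := by
  refine measure_mono_null (fun q hq => ?_) (vol_singleton hn p)
  simpa [eq_comm] using hq

theorem V_pos (n : ℕ) : 0 < V n := by
  have : 0 < Real.Gamma (((n : ℝ) + 1) / 2) := Real.Gamma_pos_of_pos (by positivity)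
  unfold V
  positivity

theorem integral_laplaceBeltrami {f : Sph n → ℝ} (hf : ContMDiff (𝓡 n) 𝓘(ℝ, ℝ) ∞ f) :
    ∫ q, laplaceBeltrami f q ∂(vol n) = 0 := by
  have h0 (q : Sph n) : laplaceBeltrami (fun _ : Sph n => (1 : ℝ)) q = 0 := by
    rw [laplaceBeltrami_eq_laplacian (F := fun _ => 1) (fun _ _ _ => rfl) (fun _ => rfl)
      contDiffAt_const]
    simp
  have h := integral_mul_laplaceBeltrami_comm hf
    (contMDiff_const : ContMDiff (𝓡 n) 𝓘(ℝ, ℝ) ∞ fun _ : Sph n => (1 : ℝ))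
  simpa [h0] using h

/-- Laplacians have mean zero, so integrating the formula for `Δ x^(m+1)` gives the recursion
satisfied by `moment`. -/
theorem integral_zonal_pow (hn : 1 ≤ n) (p : Sph n) (m : ℕ) :
    ∫ q, zonal p q ^ m ∂(vol n) = V n * moment n m := by
  have h0 : (1 : ℝ) ≤ n := by exact_mod_cast hn
  induction m with
  | zero => simp [moment, poch, ← vol_univ]
  | succ m ih =>
    have h := integral_laplaceBeltrami (contMDiff_zonal_pow p (m + 1))
    simp_rw [laplaceBeltrami_zonal_pow_succ] at h
    rw [integral_const_mul, integral_sub ((integrable_of_continuous (continuous_zonal_pow p _)).const_mul _)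
      ((integrable_of_continuous (continuous_zonal_pow p _)).const_mul _), integral_const_mul, integral_const_mul,
      ih] at h
    have h1 := (mul_eq_zero.1 h).resolve_left (by positivity)
    have h2 := moment_succ hn m
    have h3 : (m + n : ℝ) ≠ 0 := by positivity
    refine mul_left_cancel₀ h3 ?_
    linear_combination h1 - V n * h2

/-- The factor in `Δ ∑_{k < N} c_k x ^ (k + 1) = a_N x ^ N - n / 2`. -/
def peakFactor (n N : ℕ) : ℝ := coef n N * ((N + 1) * (N + n / 2))

/-- The recursions for `coef` and `moment` compensate, so all the kernels `a_N x^N` have the same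
total mass. -/
theorem peakFactor_mul_moment (hn : 1 ≤ n) (N : ℕ) : peakFactor n N * moment n N = n / 2 := by
  induction N with
  | zero => simp [peakFactor, moment, coef, poch]
  | succ N ih =>
    have h1 := coef_succ hn N
    have h2 := moment_succ hn N
    unfold peakFactor at ih ⊢
    push_cast
    linear_combination ih + moment n (N + 1) * h1 + coef n N * (N + 1) * h2

theorem sum_coef_mul_laplaceBeltrami (hn : 1 ≤ n) (p q : Sph n) (N : ℕ) :
    ∑ k ∈ Finset.range N, coef n k * laplaceBeltrami (fun q => zonal p q ^ (k + 1)) q =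
      peakFactor n N * zonal p q ^ N - n / 2 := by
  induction N with
  | zero => simp [peakFactor, coef, poch]
  | succ N ih =>
    have h1 := coef_succ hn N
    rw [Finset.sum_range_succ, ih, laplaceBeltrami_zonal_pow_succ]
    unfold peakFactor
    push_cast
    linear_combination -zonal p q ^ (N + 1) * h1

/-- Stated for integrable `D` so as to serve twice: `D = f` for existence, and `D = G p`, possibly
singular, for uniqueness. -/
theorem sum_coef_mul_integral (hn : 1 ≤ n) (p : Sph n) {D : Sph n → ℝ} (hD : Integrable D (vol n))
    (N : ℕ) :
    ∑ k ∈ Finset.range N,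
        coef n k * ∫ q, D q * laplaceBeltrami (fun q => zonal p q ^ (k + 1)) q ∂(vol n) =
      peakFactor n N * ∫ q, zonal p q ^ N * D q ∂(vol n) - n / 2 * ∫ q, D q ∂(vol n) := by
  have hb {h : Sph n → ℝ} (hh : Continuous h) : Integrable (fun q => h q * D q) (vol n) := by
    obtain ⟨C, hC⟩ := isCompact_univ.exists_bound_of_continuousOn hh.continuousOn
    exact hD.bdd_mul (c := C) hh.aestronglyMeasurable (ae_of_all _ fun q => hC q (mem_univ q))
  rw [← integral_const_mul, ← integral_const_mul,
    ← integral_sub ((hb (continuous_zonal_pow p N)).const_mul _) (hD.const_mul _)]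
  simp_rw [← integral_const_mul]
  rw [← integral_finsetSum]
  · refine integral_congr_ae (ae_of_all _ fun q => ?_)
    have := sum_coef_mul_laplaceBeltrami hn p q N
    simp only [mul_left_comm (coef n _) (D q), ← Finset.mul_sum, this]
    ring
  · intro k _
    simp_rw [mul_comm (D _)]
    exact (hb (continuous_laplaceBeltrami (contMDiff_zonal_pow p (k + 1)))).const_mul _

/-- The functions `a_N x ^ N` are an approximate identity. -/
theorem tendsto_peakFactor_mul_integral (hn : 1 ≤ n) (p : Sph n) {D : Sph n → ℝ}
    (hD : Integrable D (vol n)) (hDp : ContinuousAt D p) :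
    Tendsto (fun N => peakFactor n N * ∫ q, zonal p q ^ N * D q ∂(vol n)) atTop
      (𝓝 (n / 2 * V n * D p)) := by
  have h := tendsto_setIntegral_pow_smul_of_unique_maximum_of_isCompact_of_integrableOn
    (μ := vol n) (g := D) (x₀ := p) isCompact_univ (continuous_zonal_right p).continuousOn
    (fun q _ hq => by rw [zonal_self]; exact zonal_lt_one hq.symm)
    (fun q _ => zonal_nonneg p q) (by rw [zonal_self]; exact one_pos) (by simp)
    hD.integrableOn hDp.continuousWithinAt
  simp only [Measure.restrict_univ, smul_eq_mul, integral_zonal_pow hn] at h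
  refine (h.const_mul (n / 2 * V n)).congr fun N => ?_
  have h1 := (moment_pos hn N).ne'
  have h2 := (V_pos n).ne'
  rw [← peakFactor_mul_moment hn N]
  field_simp

theorem integrable_profile_zonal (hn : 1 ≤ n) (p : Sph n) :
    Integrable (fun q => profile n (zonal p q)) (vol n) := by
  have hs := summable_coef_mul_moment hn
  have hnn (k : ℕ) (q : Sph n) : 0 ≤ coef n k * zonal p q ^ (k + 1) :=
    mul_nonneg (coef_pos hn k).le (pow_nonneg (zonal_nonneg p q) _)
  have hi (k : ℕ) : ∫ q, coef n k * zonal p q ^ (k + 1) ∂(vol n) =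
      V n * (coef n k * moment n (k + 1)) := by
    rw [integral_const_mul, integral_zonal_pow hn]
    ring
  have h1 := hasSum_integral_of_summable_integral_norm (μ := vol n)
    (F := fun k q => coef n k * zonal p q ^ (k + 1))
    (fun k => integrable_of_continuous (((continuous_zonal_right p).pow _).const_mul _)) (by
      simp only [Real.norm_of_nonneg (hnn _ _), hi]
      exact hs.mul_left _)
  simp only [hi] at h1
  have h2 : Integrable (fun q => ∑' k, coef n k * zonal p q ^ (k + 1)) (vol n) := by
    -- A non-integrable function has integral `0` by convention, whereas this integral is the sum of
    -- a series of positive terms.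
    refine Integrable.of_integral_ne_zero ?_
    rw [← h1.tsum_eq]
    exact (h1.summable.tsum_pos (fun k => (mul_pos (V_pos n)
      (mul_pos (coef_pos hn k) (moment_pos hn _))).le) 0 (mul_pos (V_pos n)
      (mul_pos (coef_pos hn 0) (moment_pos hn _)))).ne'
  refine (h2.sub (integrable_const (∑' k, coef n k * moment n (k + 1)))).congr ?_
  filter_upwards [ae_ne hn p] with q hq
  rw [Pi.sub_apply, profile, ← Summable.tsum_sub
    (summable_coef_mul_pow hn (zonal_nonneg p q) (zonal_lt_one hq)) hs]
  simp only [mul_sub]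

/-- Integrating the defining series against a continuous function termwise. -/
theorem hasSum_integral_profile_mul (hn : 1 ≤ n) (p : Sph n) {h : Sph n → ℝ} (hh : Continuous h) :
    HasSum (fun k => coef n k * ∫ q, (zonal p q ^ (k + 1) - moment n (k + 1)) * h q ∂(vol n))
      (∫ q, profile n (zonal p q) * h q ∂(vol n)) := by
  obtain ⟨C, hC⟩ := isCompact_univ.exists_bound_of_continuousOn hh.continuousOn
  have hz := continuous_zonal_right p
  have h1 := hasSum_integral_of_summable_integral_norm (μ := vol n)
    (F := fun k q => coef n k * (zonal p q ^ (k + 1) - moment n (k + 1)) * h q)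
    (fun k => integrable_of_continuous (by fun_prop)) (by
      refine Summable.of_nonneg_of_le (fun k => integral_nonneg fun q => norm_nonneg _)
        (fun k => ?_) ((summable_coef_mul_moment hn).mul_left (2 * C * V n))
      -- Both `x^(k+1)` and its mean are nonnegative with the same integral, whence the factor `2`.
      calc ∫ q, ‖coef n k * (zonal p q ^ (k + 1) - moment n (k + 1)) * h q‖ ∂(vol n)
          ≤ ∫ q, coef n k * (zonal p q ^ (k + 1) + moment n (k + 1)) * C ∂(vol n) := by
            refine integral_mono (integrable_of_continuous (by fun_prop))
              (integrable_of_continuous (by fun_prop)) fun q => ?_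
            have e1 := pow_nonneg (zonal_nonneg p q) (k + 1)
            have e2 := moment_pos hn (k + 1)
            have e3 := coef_pos hn k
            simp only [norm_mul, Real.norm_of_nonneg e3.le]
            gcongr
            · rw [Real.norm_eq_abs, abs_le]
              constructor <;> linarith
            · exact hC q (mem_univ q)
        _ = 2 * C * V n * (coef n k * moment n (k + 1)) := by
            rw [integral_mul_const, integral_const_mul, integral_add
              (integrable_of_continuous (continuous_zonal_pow p _)) (integrable_const _),
              integral_zonal_pow hn,
              integral_const, vol_univ, smul_eq_mul]
            ring)
  simp only [tsum_mul_right] at h1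
  simpa only [mul_assoc, integral_const_mul, profile] using h1

theorem integral_profile_zonal (hn : 1 ≤ n) (p : Sph n) :
    ∫ q, profile n (zonal p q) ∂(vol n) = 0 := by
  have h := hasSum_integral_profile_mul hn p continuous_const (h := fun _ => (1 : ℝ))
  simp only [mul_one] at h
  refine h.unique ?_
  convert hasSum_zero with k
  rw [integral_sub (integrable_of_continuous (continuous_zonal_pow p _))
    (integrable_const _), integral_zonal_pow hn, integral_const, vol_univ, smul_eq_mul, sub_self,
    mul_zero]

theorem integral_profile_mul_laplaceBeltrami (hn : 1 ≤ n) (p : Sph n) {f : Sph n → ℝ}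
    (hf : ContMDiff (𝓡 n) 𝓘(ℝ, ℝ) ∞ f) :
    ∫ q, profile n (zonal p q) * laplaceBeltrami f q ∂(vol n) =
      n / 2 * V n * f p - n / 2 * ∫ q, f q ∂(vol n) := by
  have hL := continuous_laplaceBeltrami hf
  have hz := continuous_zonal_right p
  have h1 := (hasSum_integral_profile_mul hn p hL).tendsto_sum_nat
  have hi (k : ℕ) : Integrable (fun q => zonal p q ^ (k + 1) * laplaceBeltrami f q) (vol n) :=
    integrable_of_continuous (by fun_prop)
  have h2 (k : ℕ) :
      ∫ q, (zonal p q ^ (k + 1) - moment n (k + 1)) * laplaceBeltrami f q ∂(vol n) =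
      ∫ q, f q * laplaceBeltrami (fun q => zonal p q ^ (k + 1)) q ∂(vol n) := by
    -- The constant `moment` drops out because `Δf` has mean zero; symmetry then moves `Δ` onto the
    -- power.
    simp_rw [sub_mul]
    rw [integral_sub (hi k)
      (integrable_of_continuous (hL.const_mul _)), integral_const_mul, integral_laplaceBeltrami hf,
      mul_zero, sub_zero]
    exact integral_mul_laplaceBeltrami_comm hf (contMDiff_zonal_pow p (k + 1))
  have hfi := integrable_of_continuous hf.continuous
  simp_rw [h2, sum_coef_mul_integral hn p hfi] at h1
  exact tendsto_nhds_unique h1 ((tendsto_peakFactor_mul_integral hn p hfi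
    hf.continuous.continuousAt).sub_const _)

theorem g_norm_sub (hn : 1 ≤ n) (p q : Sph n) :
    g n ‖(p : Ambient n) - (q : Ambient n)‖ = 2 / (n * V n) * profile n (zonal p q) := by
  rw [g_eq hn, zonal_eq]

theorem isGreenFunction_g (hn : 1 ≤ n) :
    IsGreenFunction n fun p q => g n ‖(p : Ambient n) - (q : Ambient n)‖ := by
  simp only [g_norm_sub hn]
  have h0 : (n : ℝ) ≠ 0 := by positivity
  have hV := (V_pos n).ne'
  refine ⟨?_, fun p => (integrable_profile_zonal hn p).const_mul _, fun p f hf => ?_,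
    fun p q _ => by rw [zonal_comm], fun p => ?_⟩
  · refine ((continuousOn_profile hn).comp continuous_zonal.continuousOn
      fun x hx => ⟨zonal_nonneg _ _, zonal_lt_one hx⟩).const_smul (2 / (n * V n))
  · simp_rw [mul_assoc]
    rw [integral_const_mul, integral_profile_mul_laplaceBeltrami hn p hf, vol_univ]
    field_simp
  · rw [integral_const_mul, integral_profile_zonal hn, mul_zero]

/-- No regularity theory is needed: `G p` is integrable and continuous at `q`, so kernels centred at
`q` recover `G p q`. Mean zero removes the constant term of the telescoped sum. -/
theorem IsGreenFunction.eq_g (hn : 1 ≤ n) {G : Sph n → Sph n → ℝ} (hG : IsGreenFunction n G)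
    {p q : Sph n} (hpq : p ≠ q) : G p q = g n ‖(p : Ambient n) - (q : Ambient n)‖ := by
  have h0 : (n : ℝ) ≠ 0 := by positivity
  have hV := (V_pos n).ne'
  have hcont : ContinuousAt (G p) q := by
    have h1 : ContinuousAt (fun x : Sph n × Sph n => G x.1 x.2) (p, q) :=
      hG.continuousOn.continuousAt ((isOpen_ne_fun continuous_fst continuous_snd).mem_nhds hpq)
    exact h1.comp (f := fun q => (p, q)) (Continuous.prodMk_right p).continuousAt
  have h1 := (tendsto_peakFactor_mul_integral hn q (hG.integrable p) hcont).congr fun N =>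
    (by rw [sum_coef_mul_integral hn q (hG.integrable p) N, hG.mean_zero, mul_zero, sub_zero] :
      _ = ∑ k ∈ Finset.range N, coef n k *
        ∫ x, G p x * laplaceBeltrami (fun x => zonal q x ^ (k + 1)) x ∂(vol n))
  have h2 (k : ℕ) : ∫ x, G p x * laplaceBeltrami (fun x => zonal q x ^ (k + 1)) x ∂(vol n) =
      zonal p q ^ (k + 1) - moment n (k + 1) := by
    rw [hG.laplacian p _ (contMDiff_zonal_pow q (k + 1)), integral_zonal_pow hn, vol_univ,
      inv_mul_cancel_left₀ hV, zonal_comm]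
  simp_rw [h2] at h1
  have h3 := tendsto_nhds_unique h1
    (tendsto_sum_profile hn (zonal_nonneg p q) (zonal_lt_one hpq))
  rw [g_norm_sub hn, ← h3]
  field_simp

end Green

end SphereGreen

end

theorem mainTheorem3 (n : ℕ) (hn : 1 ≤ n) :
    (SphereGreen.vol n).real univ = SphereGreen.V n ∧
    (∀ t : ℝ, 0 < t → t ≤ 2 → Summable (SphereGreen.greenTerm n t)) ∧
    SphereGreen.IsGreenFunction n
      (fun p q => SphereGreen.g n ‖(p : SphereGreen.Ambient n) - (q : SphereGreen.Ambient n)‖) ∧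
    ∀ G : SphereGreen.Sph n → SphereGreen.Sph n → ℝ, SphereGreen.IsGreenFunction n G →
      ∀ p q : SphereGreen.Sph n, p ≠ q →
        G p q =
          SphereGreen.g n ‖(p : SphereGreen.Ambient n) - (q : SphereGreen.Ambient n)‖ :=
  ⟨SphereGreen.vol_univ n, fun _ => SphereGreen.summable_greenTerm hn,
    SphereGreen.isGreenFunction_g hn, fun _ hG _ _ hpq => hG.eq_g hn hpq⟩
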